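/- For an integer $n\ge 2$, let $B^n(0,r)\subset\mathbb{C}^n$ denote the open Euclidean ball of radius $r$ centred at $0$. For a bounded domain (non-empty connected open set) $D\subset\mathbb{C}^n$ and $z\in D$, the squeezing function is $$s_D(z):=\sup\{s_D(z;F) : F:D\to B^n(0,1)\ \text{a holomorphic embedding with } F(z)=0\},\qquad s_D(z;F):=\sup\{r>0 : B^n(0,r)\subset F(D)\},$$ and $D$ is called holomorphic homogeneous regular if $\inf_{z\in D}s_D(z)>0$. For a domain $\Omega\subset\mathbb{C}^n$, let $K_\Omega$ be the Kobayashi pseudodistance: $K_\Omega(p,q)$ is the infimum of $\sum_{i=1}^{k}\rho(a_i,b_i)$ over all finite chains of points $p=x_0,x_1,\dots,x_k=q$ in $\Omega$, holomorphic maps $f_i$ from the open unit disc $\mathbb{D}$ to $\Omega$, and $a_i,b_i\in\mathbb{D}$ with $f_i(a_i)=x_{i-1}$ and $f_i(b_i)=x_i$, where $\rho(a,b)=\tanh^{-1}\left|\frac{a-b}{1-\bar b a}\right|$. For $A\subset\Omega$ put $K_\Omega(z;A):=\inf_{w\in A}K_\Omega(z,w)$, with $\inf\varnothing=+\infty$ and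 $\tanh(+\infty)=1$. **Theorem.** Let $\Omega\subset\mathbb{C}^n$, $n\ge2$, be a bounded domain, and let $K\subset\Omega$ be a compact set such that $D:=\Omega\setminus K$ is connected. Then $$s_D(z)\le\tanh\big(K_\Omega(z;\partial D\cap K)\big)\qquad\text{for all } z\in D.$$ In particular, if $K\ne\varnothing$, then $D$ is not holomorphic homogeneous regular. -/

import Mathlib

noncomputable section

open scoped ENNReal ComplexConjugate

/-- A holomorphic embedding of the open set `D ⊆ ℂⁿ` into `ℂⁿ`: a holomorphic map on `D` which is an
immersion and a homeomorphism onto its image (in particular injective). Values of `F` off `D` are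
irrelevant. -/
structure IsHolomorphicEmbeddingOn {n : ℕ}
    (F : EuclideanSpace ℂ (Fin n) → EuclideanSpace ℂ (Fin n))
    (D : Set (EuclideanSpace ℂ (Fin n))) : Prop where
  holomorphic : DifferentiableOn ℂ F D
  immersion : ∀ x ∈ D, Function.Injective (fderiv ℂ F x)
  embedding : Topology.IsEmbedding (D.domRestrict F)

/-- `s_D(z; F) = sup {r > 0 : Bⁿ(0, r) ⊆ F(D)}`. -/
def squeezingRadius {n : ℕ} (D : Set (EuclideanSpace ℂ (Fin n)))
    (F : EuclideanSpace ℂ (Fin n) → EuclideanSpace ℂ (Fin n)) : ℝ :=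
  sSup {r : ℝ | 0 < r ∧ Metric.ball 0 r ⊆ F '' D}

/-- The squeezing function `s_D(z)`: the supremum of `s_D(z; F)` over all holomorphic embeddings
`F : D → Bⁿ(0, 1)` with `F z = 0`. -/
def squeezingFunction {n : ℕ} (D : Set (EuclideanSpace ℂ (Fin n)))
    (z : EuclideanSpace ℂ (Fin n)) : ℝ :=
  sSup {s : ℝ | ∃ F : EuclideanSpace ℂ (Fin n) → EuclideanSpace ℂ (Fin n),
    IsHolomorphicEmbeddingOn F D ∧ Set.MapsTo F D (Metric.ball 0 1) ∧ F z = 0 ∧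
      s = squeezingRadius D F}

/-- A bounded domain `D ⊆ ℂⁿ` is holomorphic homogeneous regular if `inf_{z ∈ D} s_D(z) > 0`. -/
def IsHolomorphicHomogeneousRegular {n : ℕ} (D : Set (EuclideanSpace ℂ (Fin n))) : Prop :=
  0 < ⨅ z : D, squeezingFunction D (z : EuclideanSpace ℂ (Fin n))

/-- The Poincaré distance on the open unit disc,
`ρ(a, b) = tanh⁻¹ |(a - b) / (1 - b̄ a)|`, so that `ρ(0, b) = tanh⁻¹ |b|`. -/
def poincareDist (a b : ℂ) : ℝ :=
  Real.artanh ‖(a - b) / (1 - conj b * a)‖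

/-- A chain of `k` analytic discs in `Ω` from `p` to `q`: points `p = x 0, x 1, …, x k = q`,
holomorphic maps `f i` from the open unit disc to `Ω`, and points `a i`, `b i` of the disc with
`f i (a i) = x i` and `f i (b i) = x (i + 1)` for `i < k`. -/
structure IsDiscChain {n : ℕ} (Ω : Set (EuclideanSpace ℂ (Fin n)))
    (p q : EuclideanSpace ℂ (Fin n)) (k : ℕ) (x : ℕ → EuclideanSpace ℂ (Fin n))
    (f : ℕ → ℂ → EuclideanSpace ℂ (Fin n)) (a b : ℕ → ℂ) : Prop where
  start : x 0 = p
  finish : x k = q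
  holomorphic : ∀ i < k, DifferentiableOn ℂ (f i) (Metric.ball 0 1)
  mapsTo : ∀ i < k, Set.MapsTo (f i) (Metric.ball 0 1) Ω
  left_mem : ∀ i < k, a i ∈ Metric.ball (0 : ℂ) 1
  right_mem : ∀ i < k, b i ∈ Metric.ball (0 : ℂ) 1
  map_left : ∀ i < k, f i (a i) = x i
  map_right : ∀ i < k, f i (b i) = x (i + 1)

/-- The Kobayashi pseudodistance `K_Ω(p, q)`, for `p, q ∈ Ω`: the infimum over all chains of
analytic discs from `p` to `q` of the sum of the Poincaré distances `ρ(a i, b i)`. -/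
def kobayashiDist {n : ℕ} (Ω : Set (EuclideanSpace ℂ (Fin n)))
    (p q : EuclideanSpace ℂ (Fin n)) : ℝ≥0∞ :=
  sInf {ℓ : ℝ≥0∞ | ∃ (k : ℕ) (x : ℕ → EuclideanSpace ℂ (Fin n))
    (f : ℕ → ℂ → EuclideanSpace ℂ (Fin n)) (a b : ℕ → ℂ), IsDiscChain Ω p q k x f a b ∧
      ℓ = ENNReal.ofReal (∑ i ∈ Finset.range k, poincareDist (a i) (b i))}

/-- The Kobayashi distance `K_Ω(z; A)` from a point to a subset of `Ω`; it is `∞` if `A = ∅`. -/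
def kobayashiInfDist {n : ℕ} (Ω : Set (EuclideanSpace ℂ (Fin n)))
    (z : EuclideanSpace ℂ (Fin n)) (A : Set (EuclideanSpace ℂ (Fin n))) : ℝ≥0∞ :=
  ⨅ w ∈ A, kobayashiDist Ω z w

/-- The hyperbolic tangent on `[0, ∞]`, with `tanh ∞ = 1`. -/
def extendedTanh (t : ℝ≥0∞) : ℝ :=
  if t = ∞ then 1 else Real.tanh t.toReal

end

/-! Let F embed D in the unit ball with F(z) = 0 and B(0, r) ⊆ F(D). By Hartogs
(`exists_differentiableOn_eqOn_diff_of_isCompact`) F extends to a holomorphic F' on Ω, and the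
maximum principle (`mapsTo_ball_of_mapsTo_diff`) keeps F' in the unit ball. At p ∈ ∂D ∩ K the value
F'(p) lies outside F(D), since F is an embedding (`notMem_image_of_isEmbedding_of_mem_closure`);
hence r ≤ ‖F'(p)‖. Holomorphic maps do not increase Kobayashi distance, so artanh ‖F'(p)‖ ≤ K_Ω(z,
p) (`ofReal_artanh_norm_le_kobayashiDist`). If K ≠ ∅, connectedness of Ω provides such a p, and
letting z → p inside D makes the bound tend to 0.

Hartogs is proved by solving a ∂̄-equation. Multiply f by a cutoff c that vanishes near K and equals
1 off a compact L ⊆ Ω, and solve ∂̄u = f ∂̄c on Ω by a one-variable Cauchy transform along a fixed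
direction e. Then cf - u is holomorphic on Ω. In dimension at least two, the complex lines parallel
to e that start in a suitable half-space miss L, so u = 0 there; thus cf - u = f on a nonempty open
part of D, and the identity theorem finishes. -/

open Complex Metric Set MeasureTheory Filter Topology

/-! ### The ∂̄-operator on normed spaces -/

section
variable {E G : Type*} [NormedAddCommGroup E] [NormedSpace ℂ E]
  [NormedAddCommGroup G] [NormedSpace ℂ G]

/-- The antilinear part (times two) of the real derivative of `φ`, in the direction `v`. -/
noncomputable def dbar (φ : E → G) (z v : E) : G :=
  fderiv ℝ φ z v + I • fderiv ℝ φ z (I • v)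

/-- For real-linear T, the map v ↦ T v + i T(i v) is conjugate-linear. This lets a phase be moved
into the direction of differentiation. -/
theorem dbar_smul_right (φ : E → G) (z v : E) (a : ℂ) :
    (starRingEnd ℂ a) • dbar φ z v = dbar φ z (a • v) := by
  have key : ∀ w : E, a • w = a.re • w + a.im • (I • w) := by
    intro w
    rw [← Complex.coe_smul, ← Complex.coe_smul, smul_smul, ← add_smul, Complex.re_add_im]
  have key' : ∀ w : G, (starRingEnd ℂ a) • w = a.re • w - a.im • (I • w) := by
    intro w
    rw [← Complex.coe_smul, ← Complex.coe_smul, smul_smul, ← sub_smul]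
    congr 1
    apply Complex.ext <;> simp
  have hI : (I • I • v : E) = -v := by rw [smul_smul, I_mul_I, neg_one_smul]
  have hI' : ∀ w : G, (I • I • w : G) = -w := fun w => by
    rw [smul_smul, I_mul_I, neg_one_smul]
  have hIr : ∀ (r : ℝ) (w : G), I • r • w = r • I • w := fun r w => smul_comm _ _ _
  have hIr' : ∀ (r : ℝ) (w : E), I • r • w = r • I • w := fun r w => smul_comm _ _ _
  have e1 : I • (a • v) = a.re • (I • v) - a.im • v := by
    rw [key v, smul_add I, hIr', hIr', hI, smul_neg, sub_eq_add_neg]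
  unfold dbar
  rw [e1, key', key v]
  simp only [map_add, map_sub, map_smul, smul_add, smul_sub, smul_neg, hIr, hI']
  abel

theorem dbar_eq_zero_of_differentiableAt {φ : E → G} {z : E} (h : DifferentiableAt ℂ φ z) (v : E) :
    dbar φ z v = 0 := by
  unfold dbar
  rw [h.fderiv_restrictScalars ℝ]
  simp [smul_smul]

/-- Cauchy–Riemann: the real derivative commutes with multiplication by i, so it is complex-linear.
-/
theorem differentiableAt_of_dbar_eq_zero {φ : E → G} {z : E} (h : DifferentiableAt ℝ φ z)
    (h0 : ∀ v, dbar φ z v = 0) : DifferentiableAt ℂ φ z := by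
  have hI : ∀ v, fderiv ℝ φ z (I • v) = I • fderiv ℝ φ z v := by
    intro v
    have h1 : fderiv ℝ φ z v = -(I • fderiv ℝ φ z (I • v)) := eq_neg_of_add_eq_zero_left (h0 v)
    rw [h1, smul_neg, smul_smul, I_mul_I, neg_one_smul, neg_neg]
  have hs : ∀ (a : ℂ) (v : E), fderiv ℝ φ z (a • v) = a • fderiv ℝ φ z v := by
    intro a v
    have e1 : a • v = a.re • v + a.im • (I • v) := by
      rw [← Complex.coe_smul, ← Complex.coe_smul, smul_smul, ← add_smul, Complex.re_add_im]
    have e2 : ∀ w : G, a • w = a.re • w + a.im • (I • w) := by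
      intro w
      rw [← Complex.coe_smul, ← Complex.coe_smul, smul_smul, ← add_smul, Complex.re_add_im]
    rw [e1, e2]
    simp only [map_add, map_smul, hI]
  let L : E →L[ℂ] G :=
    { toFun := fderiv ℝ φ z
      map_add' := map_add _
      map_smul' := hs
      cont := (fderiv ℝ φ z).cont }
  exact (hasFDerivAt_of_restrictScalars (g' := fderiv ℝ φ z) (f' := L) ℝ h.hasFDerivAt
    (by ext; rfl)).differentiableAt

theorem dbar_smul {c : E → ℂ} {g : E → G} {z : E} (hc : DifferentiableAt ℝ c z)
    (hg : DifferentiableAt ℝ g z) (v : E) :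
    dbar (fun x => c x • g x) z v = c z • dbar g z v + dbar c z v • g z := by
  unfold dbar
  rw [fderiv_fun_smul hc hg]
  simp [smul_smul, add_smul, mul_comm, smul_add]
  abel

theorem dbar_congr {φ ψ : E → G} {z : E} (h : φ =ᶠ[𝓝 z] ψ) (v : E) :
    dbar φ z v = dbar ψ z v := by
  unfold dbar; rw [h.fderiv_eq]

theorem dbar_sub {φ ψ : E → G} {z : E} (hφ : DifferentiableAt ℝ φ z)
    (hψ : DifferentiableAt ℝ ψ z) (v : E) :
    dbar (fun x => φ x - ψ x) z v = dbar φ z v - dbar ψ z v := by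
  unfold dbar
  rw [fderiv_fun_sub hφ hψ]
  simp [smul_sub]
  abel

theorem ContDiff.dbar {c : E → G} {n : WithTop ℕ∞} {m : WithTop ℕ∞} (hc : ContDiff ℝ n c)
    (hm : m + 1 ≤ n) (v : E) : ContDiff ℝ m (fun x => dbar c x v) := by
  have h := hc.fderiv_right hm
  exact (h.clm_apply contDiff_const).add ((h.clm_apply contDiff_const).const_smul I)

/-- This is ∂̄² = 0, a consequence of the symmetry of the second real derivative. -/
theorem dbar_dbar_comm {c : E → G} (hc : ContDiff ℝ 2 c) (z v w : E) :
    dbar (fun x => dbar c x v) z w = dbar (fun x => dbar c x w) z v := by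
  have h1 : Differentiable ℝ (fderiv ℝ c) :=
    (hc.fderiv_right (m := 1) (by norm_num)).differentiable one_ne_zero
  have hsymm : ∀ a b, fderiv ℝ (fderiv ℝ c) z a b = fderiv ℝ (fderiv ℝ c) z b a :=
    fun a b => (hc.contDiffAt.isSymmSndFDerivAt (by simp)) a b
  have key : ∀ u a, fderiv ℝ (fun x => dbar c x u) z a
      = fderiv ℝ (fderiv ℝ c) z a u + I • fderiv ℝ (fderiv ℝ c) z a (I • u) := by
    intro u a
    have h2 : ∀ b : E, HasFDerivAt (fun x => fderiv ℝ c x b)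
        ((ContinuousLinearMap.apply ℝ G b).comp (fderiv ℝ (fderiv ℝ c) z)) z := fun b =>
      (ContinuousLinearMap.apply ℝ G b).hasFDerivAt.comp z (h1 z).hasFDerivAt
    have h3 := ((h2 u).add ((h2 (I • u)).const_smul I)).fderiv
    have : (fun x => dbar c x u) = (fun x => fderiv ℝ c x u) + I • (fun x => fderiv ℝ c x (I • u)) :=
      rfl
    rw [this]
    erw [h3]
    simp
  have e1 := key v
  have e2 := key w
  unfold dbar at e1 e2 ⊢
  rw [e1, e1, e2, e2, hsymm w v, hsymm w (I • v), hsymm (I • w) v, hsymm (I • w) (I • v)]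
  simp only [smul_add]
  abel

end

/-! ### Solving ∂̄u = A by a Cauchy transform -/

section
variable {E G : Type*} [NormedAddCommGroup E] [NormedSpace ℂ E]
  [NormedAddCommGroup G] [NormedSpace ℂ G]

theorem Continuous.integrableOn_Ioc_prod_Ioc {H : Type*} [NormedAddCommGroup H] {f : ℝ × ℝ → H}
    (hf : Continuous f) (a b c d : ℝ) : IntegrableOn f (Ioc a b ×ˢ Ioc c d) :=
  (hf.continuousOn.integrableOn_compact (isCompact_Icc.prod isCompact_Icc)).mono_set
    (prod_mono Ioc_subset_Icc_self Ioc_subset_Icc_self)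

/-- The Cauchy–Pompeiu formula on a complex line; in polar coordinates the Jacobian cancels the
modulus of the Cauchy kernel. The integrand splits into a radial derivative `f₁`, which integrates
to φ(z) because φ vanishes on the outer circle, and 1/r times an angular derivative `f₂`, which
integrates to 0 by periodicity. -/
theorem integral_dbar_polar [CompleteSpace G] {φ : E → G} (hφ : ContDiff ℝ 1 φ) (z e : E) {R : ℝ}
    (hR : 0 ≤ R) (h0 : ∀ θ : ℝ, φ (z - (R * exp (θ * I)) • e) = 0) :
    ∫ p : ℝ × ℝ in Ioc 0 R ×ˢ Ioc 0 (2 * Real.pi),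
      exp (-(p.2 * I)) • dbar φ (z - (p.1 * exp (p.2 * I)) • e) e = (2 * Real.pi) • φ z := by
  have hφ' : Continuous (fderiv ℝ φ) := hφ.continuous_fderiv one_ne_zero
  have hpt : Continuous fun p : ℝ × ℝ => z - ((p.1 : ℂ) * exp (p.2 * I)) • e := by fun_prop
  have hexp : Continuous fun p : ℝ × ℝ => exp (p.2 * I) • e := by fun_prop
  let f₁ : ℝ × ℝ → G := fun p =>
    fderiv ℝ φ (z - ((p.1 : ℂ) * exp (p.2 * I)) • e) (exp (p.2 * I) • e)
  let f₂ : ℝ × ℝ → G := fun p =>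
    I • fderiv ℝ φ (z - ((p.1 : ℂ) * exp (p.2 * I)) • e) (I • exp (p.2 * I) • e)
  have hf₁ : Continuous f₁ := (hφ'.comp hpt).clm_apply hexp
  have hf₂ : Continuous f₂ := ((hφ'.comp hpt).clm_apply (hexp.const_smul I)).const_smul I
  have hsplit : ∀ p : ℝ × ℝ,
      exp (-(p.2 * I)) • dbar φ (z - (p.1 * exp (p.2 * I)) • e) e = f₁ p + f₂ p := by
    intro p
    have : exp (-(p.2 * I)) = (starRingEnd ℂ) (exp (p.2 * I)) := by
      rw [← exp_conj]; simp
    rw [this, dbar_smul_right]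
    rfl
  simp_rw [hsplit]
  have i₁ := hf₁.integrableOn_Ioc_prod_Ioc 0 R 0 (2 * Real.pi)
  have i₂ := hf₂.integrableOn_Ioc_prod_Ioc 0 R 0 (2 * Real.pi)
  have hd : ∀ x, HasFDerivAt φ (fderiv ℝ φ x) x := fun x =>
    (hφ.differentiable one_ne_zero x).hasFDerivAt
  rw [integral_add i₁ i₂]
  have J₁ : ∫ p in Ioc 0 R ×ˢ Ioc 0 (2 * Real.pi), f₁ p = (2 * Real.pi) • φ z := by
    have inner : ∀ θ : ℝ, ∫ r in Ioc 0 R, f₁ (r, θ) = φ z := by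
      intro θ
      rw [← intervalIntegral.integral_of_le hR]
      have hder : ∀ r ∈ uIcc 0 R,
          HasDerivAt (fun r : ℝ => -φ (z - ((r : ℂ) * exp (θ * I)) • e)) (f₁ (r, θ)) r := by
        intro r _
        have h1 : HasDerivAt (fun r : ℝ => z - ((r : ℂ) * exp (θ * I)) • e)
            (-((1 * exp (θ * I)) • e)) r :=
          (((hasDerivAt_id r).ofReal_comp.mul_const _).smul_const e).const_sub z
        have h2 := ((hd _).comp_hasDerivAt r h1).neg
        refine h2.congr_deriv ?_
        simp [f₁]
      rw [intervalIntegral.integral_eq_sub_of_hasDerivAt hder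
        ((hf₁.comp (by fun_prop : Continuous fun r : ℝ => (r, θ))).intervalIntegrable _ _), h0]
      simp
    rw [Measure.volume_eq_prod, ← setIntegral_prod_swap, setIntegral_prod]
    · simp only [Prod.swap_prod_mk, inner]
      simp [Real.pi_pos.le]
    · exact (hf₁.comp continuous_swap).integrableOn_Ioc_prod_Ioc _ _ _ _
  have J₂ : ∫ p in Ioc 0 R ×ˢ Ioc 0 (2 * Real.pi), f₂ p = 0 := by
    rw [Measure.volume_eq_prod, setIntegral_prod _ i₂]
    refine (setIntegral_congr_fun measurableSet_Ioc (g := fun _ => (0 : G)) ?_).trans (by simp)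
    intro r hr
    -- The half-open interval excludes r = 0, where the primitive in θ has a pole.
    have hr0 : (r : ℂ) ≠ 0 := by exact_mod_cast hr.1.ne'
    have hder : ∀ θ ∈ uIcc 0 (2 * Real.pi),
        HasDerivAt (fun θ : ℝ => (-(I * (r : ℂ)⁻¹)) • φ (z - ((r : ℂ) * exp (θ * I)) • e))
          (f₂ (r, θ)) θ := by
      intro θ _
      have h0 : HasDerivAt (fun θ : ℝ => exp ((θ : ℂ) * I)) (exp ((θ : ℂ) * I) * (1 * I)) θ :=
        ((hasDerivAt_id θ).ofReal_comp.mul_const I).cexp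
      have h1 : HasDerivAt (fun θ : ℝ => z - ((r : ℂ) * exp (θ * I)) • e)
          (-(((r : ℂ) * (exp ((θ : ℂ) * I) * (1 * I))) • e)) θ :=
        ((h0.const_mul (r : ℂ)).smul_const e).const_sub z
      have h2 := ((hd _).comp_hasDerivAt θ h1).const_smul (-(I * (r : ℂ)⁻¹))
      refine h2.congr_deriv ?_
      have h3 : ((r : ℂ) * (exp ((θ : ℂ) * I) * (1 * I))) • e
          = r • (I • exp ((θ : ℂ) * I) • e) := by
        rw [← Complex.coe_smul, smul_smul, smul_smul]; congr 1; ring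
      rw [h3, map_neg, map_smul, ← Complex.coe_smul r, neg_smul, smul_neg, neg_neg, smul_smul,
        mul_assoc, inv_mul_cancel₀ hr0, mul_one]
    change ∫ θ in Ioc 0 (2 * Real.pi), f₂ (r, θ) = 0
    rw [← intervalIntegral.integral_of_le (by positivity),
      intervalIntegral.integral_eq_sub_of_hasDerivAt hder
        ((hf₂.comp (by fun_prop : Continuous fun θ : ℝ => (r, θ))).intervalIntegrable _ _)]
    simp
  rw [J₁, J₂, add_zero]

/-- The Cauchy transform of `A` along the complex line through `z` in the direction `e`, cut off
at radius `R` and written in polar coordinates. -/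
noncomputable def cauchyTransform (R : ℝ) (e : E) (A : E → G) (z : E) : G :=
  ((2 * Real.pi : ℝ) : ℂ)⁻¹ • ∫ p : ℝ × ℝ in Ioc 0 R ×ˢ Ioc 0 (2 * Real.pi),
    exp (-(p.2 * I)) • A (z - (p.1 * exp (p.2 * I)) • e)

/-- With the singularity absorbed by polar coordinates, one differentiates under the integral over a
bounded set, dominated by a constant. -/
theorem hasFDerivAt_cauchyTransform [CompleteSpace G] {A : E → G} (hA : ContDiff ℝ 1 A) {C : ℝ}
    (hC : ∀ x, ‖fderiv ℝ A x‖ ≤ C) (R : ℝ) (e z : E) :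
    HasFDerivAt (cauchyTransform R e A)
      (((2 * Real.pi : ℝ) : ℂ)⁻¹ • ∫ p : ℝ × ℝ in Ioc 0 R ×ˢ Ioc 0 (2 * Real.pi),
        exp (-(p.2 * I)) • fderiv ℝ A (z - (p.1 * exp (p.2 * I)) • e)) z := by
  have hA' : Continuous (fderiv ℝ A) := hA.continuous_fderiv one_ne_zero
  have hpt : ∀ z, Continuous fun p : ℝ × ℝ => z - ((p.1 : ℂ) * exp (p.2 * I)) • e := fun z => by
    fun_prop
  have hexp : Continuous fun p : ℝ × ℝ => exp (-(p.2 * I)) := by fun_prop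
  have hF : ∀ z, Continuous fun p : ℝ × ℝ =>
      exp (-(p.2 * I)) • A (z - ((p.1 : ℂ) * exp (p.2 * I)) • e) := fun z =>
    hexp.smul (hA.continuous.comp (hpt z))
  have hF' : Continuous fun p : ℝ × ℝ =>
      exp (-(p.2 * I)) • fderiv ℝ A (z - ((p.1 : ℂ) * exp (p.2 * I)) • e) :=
    hexp.smul (hA'.comp (hpt z))
  have hmain := hasFDerivAt_integral_of_dominated_of_fderiv_le (𝕜 := ℝ)
    (μ := volume.restrict (Ioc 0 R ×ˢ Ioc 0 (2 * Real.pi))) (x₀ := z)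
    (F := fun x (p : ℝ × ℝ) => exp (-(p.2 * I)) • A (x - ((p.1 : ℂ) * exp (p.2 * I)) • e))
    (F' := fun x p => exp (-(p.2 * I)) • fderiv ℝ A (x - ((p.1 : ℂ) * exp (p.2 * I)) • e))
    (bound := fun _ => C) univ_mem (Eventually.of_forall fun x => (hF x).aestronglyMeasurable)
    ((hF z).integrableOn_Ioc_prod_Ioc _ _ _ _) hF'.aestronglyMeasurable ?_
    (continuous_const.integrableOn_Ioc_prod_Ioc _ _ _ _) ?_
  · exact hmain.const_smul ((2 * Real.pi : ℝ) : ℂ)⁻¹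
  · refine Eventually.of_forall fun p x _ => ?_
    have : ‖exp (-((p.2 : ℂ) * I))‖ = 1 := by
      rw [← neg_mul, ← ofReal_neg, norm_exp_ofReal_mul_I]
    rw [norm_smul, this, one_mul]
    exact hC _
  · refine Eventually.of_forall fun p x _ => ?_
    have h1 : HasFDerivAt A _ (x - ((p.1 : ℂ) * exp (p.2 * I)) • e) :=
      (hA.differentiable one_ne_zero _).hasFDerivAt
    have h2 := h1.comp x ((hasFDerivAt_id x).sub_const (((p.1 : ℂ) * exp (p.2 * I)) • e))
    rw [ContinuousLinearMap.comp_id] at h2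
    exact h2.const_smul _

/-- Closedness exchanges ∂̄ of `A e` in direction v for ∂̄ of `A v` in direction e, the direction of
integration, where Cauchy–Pompeiu applies. -/
theorem dbar_cauchyTransform [CompleteSpace G] {A : E → E → G} (hA : ∀ v, ContDiff ℝ 1 (A v))
    {C : ℝ} {e z : E} (hC : ∀ x, ‖fderiv ℝ (A e) x‖ ≤ C)
    (hclosed : ∀ x v w, dbar (A v) x w = dbar (A w) x v) {R : ℝ} (hR : 0 ≤ R)
    (h0 : ∀ (θ : ℝ) (v : E), A v (z - (R * exp (θ * I)) • e) = 0) (v : E) :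
    dbar (cauchyTransform R e (A e)) z v = A v z := by
  have hpt : Continuous fun p : ℝ × ℝ => z - ((p.1 : ℂ) * exp (p.2 * I)) • e := by fun_prop
  have hexp : Continuous fun p : ℝ × ℝ => exp (-(p.2 * I)) := by fun_prop
  have hF' : Continuous fun p : ℝ × ℝ =>
      exp (-(p.2 * I)) • fderiv ℝ (A e) (z - ((p.1 : ℂ) * exp (p.2 * I)) • e) :=
    hexp.smul (((hA e).continuous_fderiv one_ne_zero).comp hpt)
  have hint := hF'.integrableOn_Ioc_prod_Ioc 0 R 0 (2 * Real.pi)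
  have key : ∀ w, fderiv ℝ (cauchyTransform R e (A e)) z w =
      ((2 * Real.pi : ℝ) : ℂ)⁻¹ • ∫ p : ℝ × ℝ in Ioc 0 R ×ˢ Ioc 0 (2 * Real.pi),
        exp (-(p.2 * I)) • fderiv ℝ (A e) (z - (p.1 * exp (p.2 * I)) • e) w := by
    intro w
    rw [(hasFDerivAt_cauchyTransform (hA e) hC R e z).fderiv, _root_.smul_apply,
      ContinuousLinearMap.integral_apply hint]
    rfl
  have hint' : ∀ w, IntegrableOn (fun p : ℝ × ℝ =>
      exp (-(p.2 * I)) • fderiv ℝ (A e) (z - ((p.1 : ℂ) * exp (p.2 * I)) • e) w)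
      (Ioc 0 R ×ˢ Ioc 0 (2 * Real.pi)) := fun w =>
    (hexp.smul ((((hA e).continuous_fderiv one_ne_zero).comp hpt).clm_apply
      continuous_const)).integrableOn_Ioc_prod_Ioc _ _ _ _
  have step : dbar (cauchyTransform R e (A e)) z v =
      ((2 * Real.pi : ℝ) : ℂ)⁻¹ • ∫ p : ℝ × ℝ in Ioc 0 R ×ˢ Ioc 0 (2 * Real.pi),
        exp (-(p.2 * I)) • dbar (A v) (z - (p.1 * exp (p.2 * I)) • e) e := by
    unfold dbar
    rw [key, key, smul_comm I, ← smul_add, ← integral_smul]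
    erw [← integral_add (hint' v) ((hint' (I • v)).smul I)]
    congr 1
    refine integral_congr_ae (Eventually.of_forall fun p => ?_)
    have := hclosed (z - (p.1 * exp (p.2 * I)) • e) e v
    unfold dbar at this
    simp only [Pi.smul_apply]
    rw [smul_comm I, ← smul_add, this]
  rw [step, integral_dbar_polar (hA v) z e hR (fun θ => h0 θ v), ← Complex.coe_smul, smul_smul,
    inv_mul_cancel₀ (by exact_mod_cast Real.two_pi_pos.ne'), one_smul]

end

/-! ### Holomorphic maps in several variables: regularity, identity theorem, cutoffs -/

section
variable {E G : Type*} [NormedAddCommGroup E] [NormedSpace ℂ E]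
  [NormedAddCommGroup G] [NormedSpace ℂ G]

/-- Uniform continuity makes the difference of f and its translate by y - x small on a ball, and the
Cauchy estimate transfers this to the derivatives at x. -/
theorem DifferentiableOn.continuousOn_fderiv_of_isOpen [FiniteDimensional ℂ E] {f : E → G}
    {U : Set E} (hf : DifferentiableOn ℂ f U) (hU : IsOpen U) :
    ContinuousOn (fderiv ℂ f) U := by
  have : ProperSpace E := FiniteDimensional.proper ℂ E
  intro x hx
  refine ContinuousAt.continuousWithinAt (Metric.continuousAt_iff.2 fun ε hε => ?_)
  obtain ⟨r, hr, hrU⟩ := nhds_basis_closedBall.mem_iff.1 (hU.mem_nhds hx)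
  have huc := (isCompact_closedBall x r).uniformContinuousOn_of_continuous
    (hf.continuousOn.mono hrU)
  -- This bound puts the difference within ε(r/2)/2 of its value at x; dividing by the radius r/2
  -- gives ε/2.
  obtain ⟨δ, hδ, hδf⟩ := Metric.uniformContinuousOn_iff.1 huc (ε * (r / 2) / 4) (by positivity)
  refine ⟨min δ (r / 2), by positivity, fun {y} hy => ?_⟩
  have hyδ : ‖y - x‖ < δ := by
    rw [← dist_eq_norm]; exact hy.trans_le (min_le_left _ _)
  have hyr : ‖y - x‖ < r / 2 := by
    rw [← dist_eq_norm]; exact hy.trans_le (min_le_right _ _)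
  have hball : ∀ w ∈ ball x (r / 2), w + (y - x) ∈ closedBall x r ∧ w ∈ closedBall x r := by
    intro w hw
    rw [mem_ball, dist_eq_norm] at hw
    rw [mem_closedBall, mem_closedBall, dist_eq_norm, dist_eq_norm]
    constructor
    · calc ‖w + (y - x) - x‖ = ‖(w - x) + (y - x)‖ := by congr 1; abel
        _ ≤ ‖w - x‖ + ‖y - x‖ := norm_add_le _ _
        _ ≤ r := by linarith
    · linarith
  have hg : DifferentiableOn ℂ (fun w => f (w + (y - x)) - f w) (ball x (r / 2)) := by
    intro w hw
    have h1 := hf.differentiableAt (hU.mem_nhds (hrU (hball w hw).1))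
    have h2 := hf.differentiableAt (hU.mem_nhds (hrU (hball w hw).2))
    exact ((h1.comp w (differentiableAt_id.add_const _)).sub h2).differentiableWithinAt
  have hsmall : ∀ w ∈ ball x (r / 2), ‖f (w + (y - x)) - f w‖ < ε * (r / 2) / 4 := by
    intro w hw
    rw [← dist_eq_norm]
    refine hδf _ (hball w hw).1 _ (hball w hw).2 ?_
    rw [dist_eq_norm]; simpa using hyδ
  have hx0 : x ∈ ball x (r / 2) := mem_ball_self (by positivity)
  have hmaps : MapsTo (fun w => f (w + (y - x)) - f w) (ball x (r / 2))
      (closedBall (f (x + (y - x)) - f x) (ε * (r / 2) / 2)) := by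
    intro w hw
    rw [mem_closedBall, dist_eq_norm]
    refine (norm_sub_le _ _).trans ?_
    have := hsmall w hw
    have := hsmall x hx0
    linarith
  have key := Complex.norm_fderiv_le_div_of_mapsTo_ball hg hmaps (by positivity)
  have h1 := hf.differentiableAt (hU.mem_nhds (hrU (hball x hx0).1))
  have h2 := hf.differentiableAt (hU.mem_nhds hx)
  have h3 : fderiv ℂ (fun w => f (w + (y - x)) - f w) x = fderiv ℂ f y - fderiv ℂ f x := by
    rw [fderiv_fun_sub (f := fun w => f (w + (y - x))) (h1.comp x (differentiableAt_id.add_const _)) h2,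
      fderiv_comp_add_right]
    simp
  rw [h3] at key
  rw [dist_eq_norm]
  refine key.trans_lt ?_
  rw [div_lt_iff₀ (by positivity)]
  have : 0 < ε * (r / 2) := by positivity
  linarith

theorem DifferentiableOn.contDiffOn_one_of_isOpen [FiniteDimensional ℂ E] {f : E → G}
    {U : Set E} (hf : DifferentiableOn ℂ f U) (hU : IsOpen U) : ContDiffOn ℝ 1 f U := by
  have : ContDiffOn ℂ 1 f U := by
    rw [show (1 : WithTop ℕ∞) = 0 + 1 from (zero_add _).symm,
      contDiffOn_succ_iff_fderiv_of_isOpen hU]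
    exact ⟨hf, by simp, contDiffOn_zero.2 (hf.continuousOn_fderiv_of_isOpen hU)⟩
  exact this.restrict_scalars ℝ

/-- The set where the germs agree is open; it is relatively closed by the one-variable identity
theorem on complex lines through a nearby point of agreement. -/
theorem DifferentiableOn.eqOn_of_isPreconnected_of_eventuallyEq [CompleteSpace G] {f g : E → G}
    {U : Set E} (hf : DifferentiableOn ℂ f U) (hg : DifferentiableOn ℂ g U) (hU : IsOpen U)
    (hc : IsPreconnected U) {z : E} (hz : z ∈ U) (hfg : f =ᶠ[𝓝 z] g) : EqOn f g U := by
  suffices U ⊆ {x | f =ᶠ[𝓝 x] g} from fun x hx => (this hx).self_of_nhds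
  refine hc.subset_of_closure_inter_subset isOpen_setOfPred_eventually_nhds ⟨z, hz, hfg⟩ ?_
  rintro p ⟨hp, hpU⟩
  obtain ⟨r, hr, hrU⟩ := Metric.isOpen_iff.1 hU p hpU
  obtain ⟨q, hq, hqp⟩ := Metric.mem_closure_iff.1 hp r hr
  filter_upwards [ball_mem_nhds p hr] with x hx
  let γ : ℂ → E := fun t => q + t • (x - q)
  have hγ : Differentiable ℂ γ := by fun_prop
  have hV : IsOpen (γ ⁻¹' ball p r) := isOpen_ball.preimage hγ.continuous
  have hVc : Convex ℝ (γ ⁻¹' ball p r) := by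
    intro s hs t ht a b ha hb hab
    have : γ (a • s + b • t) = a • γ s + b • γ t := by
      have e : a • q + b • q = q := by rw [← add_smul, hab, one_smul]
      simp only [γ, add_smul, smul_add, ← Complex.coe_smul, smul_eq_mul, mul_smul]
      simp only [Complex.coe_smul]
      nth_rewrite 1 [← e]
      abel
    rw [mem_preimage, this]
    exact convex_ball p r hs ht ha hb hab
  have ha : ∀ {φ : E → G}, DifferentiableOn ℂ φ U → AnalyticOnNhd ℂ (φ ∘ γ) (γ ⁻¹' ball p r) :=
    fun hφ => (hφ.comp hγ.differentiableOn fun t ht => hrU ht).analyticOnNhd hV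
  have h0 : (0 : ℂ) ∈ γ ⁻¹' ball p r := by
    simp only [mem_preimage, γ, zero_smul, add_zero, mem_ball]
    rwa [dist_comm]
  have h1 : (1 : ℂ) ∈ γ ⁻¹' ball p r := by simpa [γ] using hx
  have hev : f ∘ γ =ᶠ[𝓝 0] g ∘ γ := by
    have : Tendsto γ (𝓝 0) (𝓝 q) := by
      have := hγ.continuous.tendsto 0
      simpa [γ] using this
    exact this.eventually hq
  have := (ha hf).eqOn_of_preconnected_of_eventuallyEq (ha hg) hVc.isPreconnected h0 hev h1
  simpa [γ] using this

open scoped ContDiff Manifold in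
theorem exists_contDiff_cutoff [FiniteDimensional ℂ E] {K Ω : Set E} (hK : IsCompact K)
    (hΩ : IsOpen Ω) (hKΩ : K ⊆ Ω) : ∃ (L : Set E) (c : E → ℂ), IsCompact L ∧ K ⊆ L ∧ L ⊆ Ω ∧
      ContDiff ℝ 2 c ∧ (∀ x ∈ K, c =ᶠ[𝓝 x] 0) ∧ ∀ x ∉ L, c x = 1 := by
  have : ProperSpace E := FiniteDimensional.proper ℂ E
  obtain ⟨L, hL, hKL, hLΩ⟩ := exists_compact_between hK hΩ hKΩ
  obtain ⟨χ, h1, h0, -⟩ := exists_contMDiffMap_one_nhds_of_subset_interior (n := 2) 𝓘(ℝ, E)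
    hK.isClosed hKL
  refine ⟨L, fun x => ((1 - χ x : ℝ) : ℂ), hL, hKL.trans interior_subset, hLΩ, ?_, ?_, ?_⟩
  · exact ofRealCLM.contDiff.comp (contDiff_const.sub χ.contMDiff.contDiff)
  · intro x hx
    filter_upwards [(eventually_nhdsSet_iff_forall.1 h1) x hx] with y hy
    simp [hy]
  · intro x hx
    simp [h0 x hx]

/-- This is where dimension at least two enters Hartogs: ℓ is constant along the lines on which the
Cauchy transform integrates. -/
theorem exists_linearMap_apply_eq_zero_of_two_le_finrank (h : 2 ≤ Module.finrank ℂ E) :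
    ∃ (e : E) (ℓ : E →ₗ[ℂ] ℂ), e ≠ 0 ∧ ℓ ≠ 0 ∧ ℓ e = 0 := by
  have : Nontrivial E := Module.nontrivial_of_finrank_pos (R := ℂ) (by omega)
  obtain ⟨e, he⟩ := exists_ne (0 : E)
  have hlt : Submodule.span ℂ {e} < ⊤ := by
    rw [lt_top_iff_ne_top]
    intro htop
    have h1 := finrank_span_singleton (K := ℂ) he
    rw [htop, finrank_top] at h1
    omega
  obtain ⟨ℓ, hℓ, hker⟩ := Submodule.exists_le_ker_of_lt_top _ hlt
  exact ⟨e, ℓ, he, hℓ, hker (Submodule.mem_span_singleton_self e)⟩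

end

/-! ### Hartogs extension -/

section
variable {E G : Type*} [NormedAddCommGroup E] [NormedSpace ℂ E]
  [NormedAddCommGroup G] [NormedSpace ℂ G]

/-- **Hartogs extension theorem**: a holomorphic map on `Ω \ K`, where `Ω` is a bounded open set in
a complex vector space of dimension at least two and `K ⊆ Ω` is compact with `Ω \ K` connected,
extends holomorphically to `Ω`. -/
theorem exists_differentiableOn_eqOn_diff_of_isCompact [FiniteDimensional ℂ E] [CompleteSpace G]
    (hE : 2 ≤ Module.finrank ℂ E) {Ω K : Set E} (hΩ : IsOpen Ω) (hΩb : Bornology.IsBounded Ω)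
    (hK : IsCompact K) (hKΩ : K ⊆ Ω) (hD : IsPreconnected (Ω \ K)) {f : E → G}
    (hf : DifferentiableOn ℂ f (Ω \ K)) :
    ∃ F : E → G, DifferentiableOn ℂ F Ω ∧ EqOn F f (Ω \ K) := by
  classical
  rcases K.eq_empty_or_nonempty with rfl | hKne
  · exact ⟨f, by simpa using hf, fun _ _ => rfl⟩
  have hDo : IsOpen (Ω \ K) := hΩ.sdiff hK.isClosed
  obtain ⟨L, c, hL, hKL, hLΩ, hc, hcK, hcL⟩ := exists_contDiff_cutoff hK hΩ hKΩ
  obtain ⟨e, ℓ, he, hℓ, hℓe⟩ := exists_linearMap_apply_eq_zero_of_two_le_finrank hE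
  have hcd : Differentiable ℝ c := hc.differentiable two_ne_zero
  have hdc : ∀ v, ContDiff ℝ 1 fun x => dbar c x v := fun v => hc.dbar (by norm_num) v
  have hdL : ∀ x ∉ L, ∀ v, dbar c x v = 0 := by
    intro x hx v
    have : c =ᶠ[𝓝 x] fun _ => 1 := by
      filter_upwards [hL.isClosed.isOpen_compl.mem_nhds hx] with y hy using hcL y hy
    rw [dbar_congr this, dbar_eq_zero_of_differentiableAt (differentiableAt_const _)]
  have hdK : ∀ x ∈ K, ∀ᶠ y in 𝓝 x, ∀ v, dbar c y v = 0 := by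
    intro x hx
    filter_upwards [eventually_eventually_nhds.2 (hcK x hx)] with y hy v
    rw [dbar_congr (ψ := fun _ => 0) hy, dbar_eq_zero_of_differentiableAt (differentiableAt_const _)]
  set g : E → G := (Ω \ K).indicator f with hg
  have hgf : ∀ x ∈ Ω \ K, g =ᶠ[𝓝 x] f := fun x hx => by
    filter_upwards [hDo.mem_nhds hx] with y hy using indicator_of_mem hy f
  have hgd : ∀ x ∈ Ω \ K, DifferentiableAt ℂ g x := fun x hx =>
    (hf.differentiableAt (hDo.mem_nhds hx)).congr_of_eventuallyEq (hgf x hx)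
  have hgc : ∀ x ∈ Ω \ K, ContDiffAt ℝ 1 g x := fun x hx =>
    ((hf.contDiffOn_one_of_isOpen hDo).contDiffAt (hDo.mem_nhds hx)).congr_of_eventuallyEq (hgf x hx)
  -- The form ∂̄(cg). It is C¹ everywhere because ∂̄c vanishes near K and off L, so the zero
  -- extension `g` does no harm.
  let A : E → E → G := fun v x => dbar c x v • g x
  have hA0 : ∀ x ∉ Ω \ K, ∀ v, A v =ᶠ[𝓝 x] fun _ => 0 := by
    intro x hx v
    by_cases hxK : x ∈ K
    · filter_upwards [hdK x hxK] with y hy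
      simp [A, hy v]
    · have hxL : x ∉ L := fun h => hx ⟨hLΩ h, hxK⟩
      filter_upwards [hL.isClosed.isOpen_compl.mem_nhds hxL] with y hy
      simp [A, hdL y hy v]
  have hAL : ∀ x ∉ L, ∀ v, A v x = 0 := fun x hx v => by simp [A, hdL x hx v]
  have hA : ∀ v, ContDiff ℝ 1 (A v) := by
    intro v
    rw [contDiff_iff_contDiffAt]
    intro x
    by_cases hx : x ∈ Ω \ K
    · exact (hdc v).contDiffAt.smul (hgc x hx)
    · exact contDiffAt_const.congr_of_eventuallyEq (hA0 x hx v)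
  have hclosed : ∀ x v w, dbar (A v) x w = dbar (A w) x v := by
    intro x v w
    by_cases hx : x ∈ Ω \ K
    · have hgr := (hgd x hx).restrictScalars ℝ
      have h1 : ∀ v w, dbar (A v) x w = dbar (fun y => dbar c y v) x w • g x := fun v w => by
        rw [dbar_smul ((hdc v).differentiable one_ne_zero x) hgr,
          dbar_eq_zero_of_differentiableAt (hgd x hx), smul_zero, zero_add]
      rw [h1, h1, dbar_dbar_comm hc]
    · rw [dbar_congr (hA0 x hx v), dbar_congr (hA0 x hx w),
        dbar_eq_zero_of_differentiableAt (differentiableAt_const _),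
        dbar_eq_zero_of_differentiableAt (differentiableAt_const _)]
  have hsupp : HasCompactSupport (A e) := HasCompactSupport.intro hL fun x hx => hAL x hx e
  obtain ⟨C, hC⟩ := ((hA e).continuous_fderiv one_ne_zero).bounded_above_of_compact_support
    (hsupp.fderiv (𝕜 := ℝ))
  obtain ⟨M, hM, hMΩ⟩ := hΩb.subset_ball_lt 0 0
  have he0 : 0 < ‖e‖ := norm_pos_iff.2 he
  -- A step of length R‖e‖ = 2M from a point of Ω leaves the ball of radius M, hence misses L.
  set R : ℝ := 2 * M / ‖e‖ with hR
  have hR0 : 0 ≤ R := by positivity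
  have hfar : ∀ z ∈ Ω, ∀ (θ : ℝ) v, A v (z - (R * exp (θ * I)) • e) = 0 := by
    intro z hz θ v
    refine hAL _ (fun hmem => ?_) v
    have h1 := mem_ball_zero_iff.1 (hMΩ hz)
    have h2 := mem_ball_zero_iff.1 (hMΩ (hLΩ hmem))
    have h3 : ‖((R : ℂ) * exp (θ * I)) • e‖ = 2 * M := by
      rw [norm_smul, norm_mul, norm_exp_ofReal_mul_I, mul_one, norm_real, Real.norm_of_nonneg hR0,
        hR, div_mul_cancel₀ _ he0.ne']
    have h4 := norm_sub_le z (z - ((R : ℂ) * exp (θ * I)) • e)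
    rw [sub_sub_cancel, h3] at h4
    linarith
  set u : E → G := cauchyTransform R e (A e)
  have hud : ∀ x, DifferentiableAt ℝ u x := fun x =>
    (hasFDerivAt_cauchyTransform (hA e) hC R e x).differentiableAt
  have hcg0 : ∀ x ∈ K, (fun y => c y • g y) =ᶠ[𝓝 x] fun _ => 0 := by
    intro x hx
    filter_upwards [hcK x hx] with y hy
    simp [hy]
  have hcgd : ∀ x ∈ Ω, DifferentiableAt ℝ (fun y => c y • g y) x := by
    intro x hx
    by_cases hxK : x ∈ K
    · exact (differentiableAt_const _).congr_of_eventuallyEq (hcg0 x hxK)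
    · exact (hcd x).smul ((hgd x ⟨hx, hxK⟩).restrictScalars ℝ)
  have hcgdbar : ∀ x ∈ Ω, ∀ v, dbar (fun y => c y • g y) x v = A v x := by
    intro x hx v
    by_cases hxK : x ∈ K
    · rw [dbar_congr (hcg0 x hxK), dbar_eq_zero_of_differentiableAt (differentiableAt_const _),
        (hA0 x (fun h => h.2 hxK) v).self_of_nhds]
    · rw [dbar_smul (hcd x) ((hgd x ⟨hx, hxK⟩).restrictScalars ℝ),
        dbar_eq_zero_of_differentiableAt (hgd x ⟨hx, hxK⟩), smul_zero, zero_add]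
  have hF : DifferentiableOn ℂ (fun x => c x • g x - u x) Ω := by
    intro x hx
    refine (differentiableAt_of_dbar_eq_zero ((hcgd x hx).sub (hud x))
      fun v => ?_).differentiableWithinAt
    refine (dbar_sub (hcgd x hx) (hud x) v).trans ?_
    rw [hcgdbar x hx, dbar_cauchyTransform hA hC hclosed hR0 (hfar x hx), sub_self]
  refine ⟨_, hF, ?_⟩
  have hℓc : Continuous ℓ := ℓ.continuous_of_finiteDimensional
  have hrec : Continuous fun x => (ℓ x).re := continuous_re.comp hℓc
  -- Beyond the maximum of Re ℓ on L lies a half-space invariant under translation along e and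
  -- disjoint from L, so u vanishes there. Since p ∈ L ⊆ Ω, it meets D near p.
  obtain ⟨p, hpL, hpmax⟩ := hL.exists_isMaxOn (hKne.mono hKL) hrec.continuousOn
  have hmax : ∀ x, (ℓ p).re < (ℓ x).re → x ∉ L := fun x hx hxL => (hpmax hxL).not_gt hx
  have hu0 : ∀ x, (ℓ p).re < (ℓ x).re → u x = 0 := by
    intro x hx
    have : ∀ a : ℂ, A e (x - a • e) = 0 := fun a =>
      hAL _ (hmax _ (by rw [map_sub, map_smul, hℓe, smul_zero, sub_zero]; exact hx)) e
    simp [u, cauchyTransform, this]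
  obtain ⟨v, hv⟩ : ∃ v, ℓ v = 1 := by
    obtain ⟨w, hw⟩ := DFunLike.ne_iff.1 hℓ
    exact ⟨(ℓ w)⁻¹ • w, by rw [map_smul, smul_eq_mul, inv_mul_cancel₀ hw]⟩
  have htend : Tendsto (fun t : ℝ => p + (t : ℂ) • v) (𝓝[>] 0) (𝓝 p) := by
    have : Continuous fun t : ℝ => p + (t : ℂ) • v := by fun_prop
    have := this.tendsto 0
    simp only [ofReal_zero, zero_smul, add_zero] at this
    exact this.mono_left nhdsWithin_le_nhds
  obtain ⟨t, htΩ, ht⟩ := ((htend.eventually (hΩ.mem_nhds (hLΩ hpL))).and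
    self_mem_nhdsWithin).exists
  have hq : (ℓ p).re < (ℓ (p + (t : ℂ) • v)).re := by
    rw [map_add, map_smul, hv, add_re]
    simpa using ht
  have hqD : p + (t : ℂ) • v ∈ Ω \ K := ⟨htΩ, fun h => hmax _ hq (hKL h)⟩
  refine (hF.mono sdiff_subset).eqOn_of_isPreconnected_of_eventuallyEq hf hDo hD hqD ?_
  filter_upwards [hgf _ hqD, (isOpen_lt continuous_const hrec).mem_nhds hq] with x hx hxℓ
  rw [hcL x (hmax x hxℓ), hu0 x hxℓ, hx, one_smul, sub_zero]

end

/-! ### Disc automorphisms and Schwarz–Pick -/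

section
open ComplexConjugate

theorem Real.artanh_add {x y : ℝ} (hx : x ∈ Ioo (-1) 1) (hy : y ∈ Ioo (-1) 1) :
    artanh x + artanh y = artanh ((x + y) / (1 + x * y)) := by
  have hx1 : 0 < 1 + x := by linarith [hx.1]
  have hx2 : 0 < 1 - x := by linarith [hx.2]
  have hy1 : 0 < 1 + y := by linarith [hy.1]
  have hy2 : 0 < 1 - y := by linarith [hy.2]
  have hd : 0 < 1 + x * y := by nlinarith [mul_pos hx1 hy1, mul_pos hx2 hy2]
  have h1 : 1 + (x + y) / (1 + x * y) = (1 + x) * (1 + y) / (1 + x * y) := by field_simp; ring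
  have h2 : 1 - (x + y) / (1 + x * y) = (1 - x) * (1 - y) / (1 + x * y) := by field_simp; ring
  have hmem : (x + y) / (1 + x * y) ∈ Icc (-1 : ℝ) 1 := by
    constructor
    · have : 0 < 1 + (x + y) / (1 + x * y) := by rw [h1]; positivity
      linarith
    · have : 0 < 1 - (x + y) / (1 + x * y) := by rw [h2]; positivity
      linarith
  rw [Real.artanh_eq_half_log (Ioo_subset_Icc_self hx),
    Real.artanh_eq_half_log (Ioo_subset_Icc_self hy), Real.artanh_eq_half_log hmem, h1, h2,
    ← mul_add, ← Real.log_mul (by positivity) (by positivity)]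
  congr 2
  field_simp

/-- The automorphism of the unit disc that maps `0` to `a`. -/
noncomputable def discAut (a z : ℂ) : ℂ := (z + a) / (1 + conj a * z)

theorem one_add_conj_mul_ne_zero {a z : ℂ} (ha : ‖a‖ < 1) (hz : ‖z‖ < 1) : 1 + conj a * z ≠ 0 := by
  intro h
  have h1 : ‖conj a * z‖ = 1 := by
    rw [eq_neg_of_add_eq_zero_right h, norm_neg, norm_one]
  rw [norm_mul, RCLike.norm_conj] at h1
  nlinarith [norm_nonneg a, norm_nonneg z]

theorem one_sub_norm_discAut_sq {a z : ℂ} (ha : ‖a‖ < 1) (hz : ‖z‖ < 1) :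
    1 - ‖discAut a z‖ ^ 2 = (1 - ‖a‖ ^ 2) * (1 - ‖z‖ ^ 2) / ‖1 + conj a * z‖ ^ 2 := by
  have h : ‖1 + conj a * z‖ ^ 2 ≠ 0 :=
    pow_ne_zero _ (norm_ne_zero_iff.2 (one_add_conj_mul_ne_zero ha hz))
  rw [discAut, norm_div, div_pow, eq_div_iff h, sub_mul, div_mul_cancel₀ _ h]
  simp only [← normSq_eq_norm_sq, normSq_apply]
  simp
  ring

theorem norm_discAut_lt_one {a z : ℂ} (ha : ‖a‖ < 1) (hz : ‖z‖ < 1) : ‖discAut a z‖ < 1 := by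
  have h : 0 < ‖1 + conj a * z‖ := norm_pos_iff.2 (one_add_conj_mul_ne_zero ha hz)
  have h1 : 0 < 1 - ‖a‖ ^ 2 := by nlinarith [norm_nonneg a]
  have h2 : 0 < 1 - ‖z‖ ^ 2 := by nlinarith [norm_nonneg z]
  have : 0 < 1 - ‖discAut a z‖ ^ 2 := by rw [one_sub_norm_discAut_sq ha hz]; positivity
  nlinarith [norm_nonneg (discAut a z)]

/-- In `one_sub_norm_discAut_sq` the denominator is largest when |1 + āz| = 1 + |a||z|, and that
case gives the right-hand side. -/
theorem norm_discAut_le {a z : ℂ} (ha : ‖a‖ < 1) (hz : ‖z‖ < 1) :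
    ‖discAut a z‖ ≤ (‖a‖ + ‖z‖) / (1 + ‖a‖ * ‖z‖) := by
  have h : 0 < ‖1 + conj a * z‖ := norm_pos_iff.2 (one_add_conj_mul_ne_zero ha hz)
  have h1 : 0 < 1 - ‖a‖ ^ 2 := by nlinarith [norm_nonneg a]
  have h2 : 0 < 1 - ‖z‖ ^ 2 := by nlinarith [norm_nonneg z]
  have h3 : ‖1 + conj a * z‖ ≤ 1 + ‖a‖ * ‖z‖ := by
    refine (norm_add_le _ _).trans ?_
    rw [norm_one, norm_mul, RCLike.norm_conj]
  have h4 : (1 - ‖a‖ ^ 2) * (1 - ‖z‖ ^ 2) / (1 + ‖a‖ * ‖z‖) ^ 2 ≤ 1 - ‖discAut a z‖ ^ 2 := by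
    rw [one_sub_norm_discAut_sq ha hz]
    gcongr
  have h5 : (1 - ‖a‖ ^ 2) * (1 - ‖z‖ ^ 2) / (1 + ‖a‖ * ‖z‖) ^ 2
      = 1 - ((‖a‖ + ‖z‖) / (1 + ‖a‖ * ‖z‖)) ^ 2 := by
    have : 0 < 1 + ‖a‖ * ‖z‖ := by positivity
    field_simp
    ring
  rw [h5] at h4
  exact le_of_sq_le_sq (by linarith) (by positivity)

theorem artanh_norm_discAut_le {a z : ℂ} (ha : ‖a‖ < 1) (hz : ‖z‖ < 1) :
    Real.artanh ‖discAut a z‖ ≤ Real.artanh ‖a‖ + Real.artanh ‖z‖ := by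
  have ha' : ‖a‖ ∈ Ioo (-1 : ℝ) 1 := ⟨by linarith [norm_nonneg a], ha⟩
  have hz' : ‖z‖ ∈ Ioo (-1 : ℝ) 1 := ⟨by linarith [norm_nonneg z], hz⟩
  rw [Real.artanh_add ha' hz']
  refine Real.artanh_le_artanh (by linarith [norm_nonneg (discAut a z)]) ?_ (norm_discAut_le ha hz)
  rw [div_lt_one (by positivity)]
  nlinarith

theorem discAut_discAut_neg {a z : ℂ} (ha : ‖a‖ < 1) (hz : ‖z‖ < 1) :
    discAut a (discAut (-a) z) = z := by
  have h1 : 1 - conj a * z ≠ 0 := by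
    simpa [sub_eq_add_neg] using
      one_add_conj_mul_ne_zero (a := -a) (z := z) (by rwa [norm_neg]) hz
  have h2 : 1 - conj a * a ≠ 0 := by
    simpa [sub_eq_add_neg] using
      one_add_conj_mul_ne_zero (a := -a) (z := a) (by rwa [norm_neg]) ha
  have e1 : discAut (-a) z = (z - a) / (1 - conj a * z) := by
    simp [discAut, sub_eq_add_neg]
  have e2 : (z - a) / (1 - conj a * z) + a = z * (1 - conj a * a) / (1 - conj a * z) := by
    rw [div_add' _ _ _ h1]; congr 1; ring
  have e3 : 1 + conj a * ((z - a) / (1 - conj a * z)) = (1 - conj a * a) / (1 - conj a * z) := by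
    rw [mul_div_assoc', add_comm, div_add' _ _ _ h1]; congr 1; ring
  rw [e1, discAut, e2, e3, div_div_div_cancel_right₀ h1, mul_div_cancel_right₀ _ h2]

theorem differentiableOn_discAut {a : ℂ} (ha : ‖a‖ < 1) :
    DifferentiableOn ℂ (discAut a) (ball 0 1) := by
  intro z hz
  refine (DifferentiableAt.div (by fun_prop) (by fun_prop) ?_).differentiableWithinAt
  exact one_add_conj_mul_ne_zero ha (mem_ball_zero_iff.1 hz)

theorem mapsTo_discAut {a : ℂ} (ha : ‖a‖ < 1) : MapsTo (discAut a) (ball 0 1) (ball 0 1) :=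
  fun _ hz => mem_ball_zero_iff.2 (norm_discAut_lt_one ha (mem_ball_zero_iff.1 hz))

theorem poincareDist_eq (a b : ℂ) : poincareDist a b = Real.artanh ‖discAut (-a) b‖ := by
  have h1 : ‖1 - conj b * a‖ = ‖1 - conj a * b‖ := by
    rw [← RCLike.norm_conj]; simp [mul_comm]
  rw [poincareDist, norm_div, h1, norm_sub_rev, ← norm_div]
  simp [discAut, sub_eq_add_neg]

/-- A consequence of the **Schwarz-Pick lemma** and the triangle inequality for the Poincaré
distance. -/
theorem artanh_norm_le_add_poincareDist {h : ℂ → ℂ} (hd : DifferentiableOn ℂ h (ball 0 1))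
    (hm : MapsTo h (ball 0 1) (ball 0 1)) {a b : ℂ} (ha : a ∈ ball (0 : ℂ) 1)
    (hb : b ∈ ball (0 : ℂ) 1) :
    Real.artanh ‖h b‖ ≤ Real.artanh ‖h a‖ + poincareDist a b := by
  have ha1 := mem_ball_zero_iff.1 ha
  have hb1 := mem_ball_zero_iff.1 hb
  have hha1 := mem_ball_zero_iff.1 (hm ha)
  have hhb1 := mem_ball_zero_iff.1 (hm hb)
  have hna : ‖-a‖ < 1 := by rwa [norm_neg]
  have hnha : ‖-h a‖ < 1 := by rwa [norm_neg]
  -- Conjugating by automorphisms gives a self-map of the disc fixing 0, to which the Schwarz lemma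
  -- applies.
  let k : ℂ → ℂ := fun ζ => discAut (-h a) (h (discAut a ζ))
  have hkd : DifferentiableOn ℂ k (ball 0 1) :=
    (differentiableOn_discAut hnha).comp (hd.comp (differentiableOn_discAut ha1)
      (mapsTo_discAut ha1)) (hm.comp (mapsTo_discAut ha1))
  have hkm : MapsTo k (ball 0 1) (ball 0 1) :=
    (mapsTo_discAut hnha).comp (hm.comp (mapsTo_discAut ha1))
  have hk0 : k 0 = 0 := by simp [k, discAut]
  have hζ : ‖discAut (-a) b‖ < 1 := norm_discAut_lt_one hna hb1
  have hk : k (discAut (-a) b) = discAut (-h a) (h b) := by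
    simp only [k]; rw [discAut_discAut_neg ha1 hb1]
  have hle : ‖discAut (-h a) (h b)‖ ≤ ‖discAut (-a) b‖ := by
    rw [← hk]
    have := dist_le_dist_of_mapsTo_ball hkd
      (by rw [hk0]; exact hkm.mono_right ball_subset_closedBall) (mem_ball_zero_iff.2 hζ)
    rwa [hk0, dist_zero_right, dist_zero_right] at this
  have h1 := artanh_norm_discAut_le hha1 (norm_discAut_lt_one hnha hhb1)
  rw [discAut_discAut_neg hha1 hhb1] at h1
  rw [poincareDist_eq]
  have h2 := Real.artanh_le_artanh (by linarith [norm_nonneg (discAut (-h a) (h b))]) hζ hle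
  linarith

/-! ### Estimates for the Kobayashi pseudodistance -/

variable {n : ℕ} {Ω : Set (EuclideanSpace ℂ (Fin n))} {z p : EuclideanSpace ℂ (Fin n)}

/-- Composing g with each disc of the chain gives a self-map of 𝔻, so by Schwarz–Pick each link adds
at most its Poincaré length. -/
theorem IsDiscChain.artanh_norm_le_sum {k : ℕ} {x : ℕ → EuclideanSpace ℂ (Fin n)}
    {f : ℕ → ℂ → EuclideanSpace ℂ (Fin n)} {a b : ℕ → ℂ} (hc : IsDiscChain Ω z p k x f a b)
    {g : EuclideanSpace ℂ (Fin n) → ℂ} (hg : DifferentiableOn ℂ g Ω)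
    (hm : MapsTo g Ω (ball 0 1)) (hz : g z = 0) :
    Real.artanh ‖g p‖ ≤ ∑ i ∈ Finset.range k, poincareDist (a i) (b i) := by
  suffices ∀ j ≤ k, Real.artanh ‖g (x j)‖ ≤ ∑ i ∈ Finset.range j, poincareDist (a i) (b i) by
    simpa [hc.finish] using this k le_rfl
  intro j
  induction j with
  | zero => intro _; simp [hc.start, hz]
  | succ j ih =>
    intro hj
    have h1 := artanh_norm_le_add_poincareDist (hg.comp (hc.holomorphic j hj) (hc.mapsTo j hj))
      (hm.comp (hc.mapsTo j hj)) (hc.left_mem j hj) (hc.right_mem j hj)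
    simp only [Function.comp, hc.map_left j hj, hc.map_right j hj] at h1
    rw [Finset.sum_range_succ]
    linarith [ih (by omega)]

theorem ofReal_artanh_norm_le_kobayashiDist {G : Type*} [NormedAddCommGroup G] [NormedSpace ℂ G]
    {F : EuclideanSpace ℂ (Fin n) → G} (hF : DifferentiableOn ℂ F Ω)
    (hm : MapsTo F Ω (ball 0 1)) (hz : F z = 0) :
    ENNReal.ofReal (Real.artanh ‖F p‖) ≤ kobayashiDist Ω z p := by
  refine le_sInf ?_
  rintro _ ⟨k, x, f, a, b, hc, rfl⟩
  refine ENNReal.ofReal_le_ofReal ?_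
  -- A norming functional of `F p` reduces the vector-valued case to a scalar one.
  obtain ⟨φ, hφ, hφp⟩ := exists_dual_vector'' ℂ (F p)
  have h := hc.artanh_norm_le_sum (g := fun y => φ (F y))
    (φ.differentiable.comp_differentiableOn hF) (fun y hy => ?_) (by simp [hz])
  · simpa [hφp] using h
  · have := mem_ball_zero_iff.1 (hm hy)
    refine mem_ball_zero_iff.2 ((φ.le_of_opNorm_le hφ _).trans_lt ?_)
    simpa using this

theorem kobayashiDist_le_of_ball_subset {ρ : ℝ} (hρ : ball p ρ ⊆ Ω) (hz : z ∈ ball p ρ) :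
    kobayashiDist Ω z p ≤ ENNReal.ofReal (Real.artanh (‖z - p‖ / ρ)) := by
  have hd : ‖z - p‖ < ρ := by rwa [mem_ball, dist_eq_norm] at hz
  have hρ0 : 0 < ρ := (norm_nonneg _).trans_lt hd
  have hq : ‖z - p‖ / ρ < 1 := (div_lt_one hρ0).2 hd
  have hq0 : 0 ≤ ‖z - p‖ / ρ := by positivity
  -- A single linear disc sending 0 to p and ‖z - p‖/ρ to z. If z = p, the disc is constant.
  refine sInf_le ⟨1, fun i => if i = 0 then z else p,
    fun _ ζ => p + (ζ * ((ρ / ‖z - p‖ : ℝ) : ℂ)) • (z - p),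
    fun _ => ((‖z - p‖ / ρ : ℝ) : ℂ), fun _ => 0, ⟨by simp, by simp, ?_, ?_, ?_, ?_, ?_, ?_⟩, ?_⟩
  · intro i _
    fun_prop
  · intro i _ ζ hζ
    refine hρ ?_
    have hζ1 := mem_ball_zero_iff.1 hζ
    rw [mem_ball, dist_eq_norm, add_sub_cancel_left, norm_smul, norm_mul, norm_real,
      Real.norm_of_nonneg (by positivity)]
    rcases (norm_nonneg (z - p)).eq_or_lt with h0 | h0
    · rw [← h0, mul_zero]; exact hρ0
    · rw [mul_assoc, div_mul_cancel₀ _ h0.ne']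
      nlinarith
  · intro i _
    rw [mem_ball_zero_iff, norm_real, Real.norm_of_nonneg hq0]
    exact hq
  · intro i _
    simp
  · intro i hi
    obtain rfl : i = 0 := by omega
    rcases (norm_nonneg (z - p)).eq_or_lt with h0 | h0
    · have : z - p = 0 := norm_eq_zero.1 h0.symm
      simp [sub_eq_zero.1 this]
    · have : (‖z - p‖ / ρ) * (ρ / ‖z - p‖) = 1 := by field_simp
      rw [← ofReal_mul, this]
      simp
  · intro i hi
    simp
  · simp only [Finset.range_one, Finset.sum_singleton, poincareDist, map_zero, zero_mul, sub_zero,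
      div_one]
    rw [norm_real, Real.norm_of_nonneg hq0]

end

/-! ### Bounding the squeezing function -/

section
variable {n : ℕ} {Ω K D : Set (EuclideanSpace ℂ (Fin n))} {z p : EuclideanSpace ℂ (Fin n)}
  {F : EuclideanSpace ℂ (Fin n) → EuclideanSpace ℂ (Fin n)}

open scoped ENNReal

theorem extendedTanh_nonneg (t : ℝ≥0∞) : 0 ≤ extendedTanh t := by
  unfold extendedTanh
  split_ifs
  · exact zero_le_one
  · rw [Real.tanh_eq_sinh_div_cosh]
    exact div_nonneg (Real.sinh_nonneg_iff.2 ENNReal.toReal_nonneg) (Real.cosh_pos _).le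

theorem Real.le_tanh_iff_artanh_le {r t : ℝ} (hr : r ∈ Ioo (-1) 1) :
    r ≤ tanh t ↔ artanh r ≤ t := by
  rw [← Real.artanh_le_artanh_iff hr ⟨Real.neg_one_lt_tanh t, Real.tanh_lt_one t⟩,
    Real.artanh_tanh]

theorem le_extendedTanh {r : ℝ} {t : ℝ≥0∞} (hr : r ∈ Ioo (-1) 1)
    (h : ENNReal.ofReal (Real.artanh r) ≤ t) : r ≤ extendedTanh t := by
  unfold extendedTanh
  split_ifs with ht
  · exact hr.2.le
  · exact (Real.le_tanh_iff_artanh_le hr).2 ((ENNReal.ofReal_le_iff_le_toReal ht).1 h)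

theorem extendedTanh_le {r : ℝ} {t : ℝ≥0∞} (hr : r ∈ Ico 0 1)
    (h : t ≤ ENNReal.ofReal (Real.artanh r)) : extendedTanh t ≤ r := by
  have ht : t ≠ ∞ := (h.trans_lt ENNReal.ofReal_lt_top).ne
  have hr' : r ∈ Ioo (-1 : ℝ) 1 := ⟨by linarith [hr.1], hr.2⟩
  have h1 : t.toReal ≤ Real.artanh r :=
    ENNReal.toReal_le_of_le_ofReal (Real.artanh_nonneg hr.1) h
  rw [extendedTanh, if_neg ht, ← Real.artanh_le_artanh_iff
    ⟨Real.neg_one_lt_tanh _, Real.tanh_lt_one _⟩ hr', Real.artanh_tanh]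
  exact h1

theorem squeezingRadius_nonneg (D : Set (EuclideanSpace ℂ (Fin n)))
    (F : EuclideanSpace ℂ (Fin n) → EuclideanSpace ℂ (Fin n)) : 0 ≤ squeezingRadius D F :=
  Real.sSup_nonneg fun _ hr => hr.1.le

theorem squeezingFunction_nonneg (D : Set (EuclideanSpace ℂ (Fin n)))
    (z : EuclideanSpace ℂ (Fin n)) : 0 ≤ squeezingFunction D z := by
  refine Real.sSup_nonneg ?_
  rintro _ ⟨F, -, -, -, rfl⟩
  exact squeezingRadius_nonneg D F

theorem le_one_of_ball_subset_image (hn : 0 < n) (hm : MapsTo F D (ball 0 1)) {r : ℝ}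
    (hr : ball 0 r ⊆ F '' D) : r ≤ 1 := by
  by_contra! h
  have h1 : EuclideanSpace.single (⟨0, hn⟩ : Fin n) (1 : ℂ) ∈ ball 0 r := by
    simpa using h
  have := hm.image_subset (hr h1)
  simp at this

/-- A map that is an embedding on `D` and continuous at a boundary point `p ∉ D` of `D` does not
take at `p` a value that it takes on `D`. -/
theorem notMem_image_of_isEmbedding_of_mem_closure {X Y : Type*} [TopologicalSpace X]
    [TopologicalSpace Y] [T2Space X] {F F' : X → Y} {D : Set X} {p : X}
    (hF : Topology.IsEmbedding (D.domRestrict F)) (hF' : ContinuousAt F' p) (heq : EqOn F' F D)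
    (hp : p ∈ closure D) (hpD : p ∉ D) : F' p ∉ F '' D := by
  rintro ⟨q, hq, hqp⟩
  let l : Filter D := comap Subtype.val (𝓝 p)
  have : l.NeBot := mem_closure_iff_comap_neBot.1 hp
  have hlp : Tendsto Subtype.val l (𝓝 p) := tendsto_comap
  have h1 : Tendsto (D.domRestrict F ∘ id) l (𝓝 (D.domRestrict F ⟨q, hq⟩)) := by
    change Tendsto _ l (𝓝 (F q))
    -- If F'(p) = F(q), then F tends to F(q) as D ∋ x → p; the embedding property forces x → q, so p
    -- = q ∈ D.
    rw [hqp]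
    refine (hF'.tendsto.comp hlp).congr fun x => heq x.2
  have h2 : Tendsto id l (𝓝 (⟨q, hq⟩ : D)) := hF.tendsto_nhds_iff.2 h1
  have h3 : Tendsto Subtype.val l (𝓝 q) := (continuous_subtype_val.tendsto _).comp h2
  exact hpD (tendsto_nhds_unique hlp h3 ▸ hq)

/-- If `F` is holomorphic on `Ω` and maps `Ω \ K` to the unit ball, where `K` is compact, then it
maps `Ω` to the unit ball. -/
theorem mapsTo_ball_of_mapsTo_diff {E G : Type*} [NormedAddCommGroup E] [NormedSpace ℂ E]
    [NormedAddCommGroup G] [NormedSpace ℂ G] {Ω K : Set E} (hΩ : IsOpen Ω) (hc : IsPreconnected Ω)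
    (hK : IsCompact K) (hKΩ : K ⊆ Ω) (hne : (Ω \ K).Nonempty) {F : E → G}
    (hF : DifferentiableOn ℂ F Ω) (hm : MapsTo F (Ω \ K) (ball 0 1)) :
    MapsTo F Ω (ball 0 1) := by
  intro x hx
  by_contra hx1
  have hxK : x ∈ K := by_contra fun h => hx1 (hm ⟨hx, h⟩)
  -- If F leaves the ball, its largest norm on K is at least 1 and so is attained as a maximum over
  -- Ω. Then ‖F‖ is constant on Ω, contradicting ‖F‖ < 1 off K.
  obtain ⟨y, hyK, hy⟩ := hK.exists_isMaxOn ⟨x, hxK⟩ (hF.continuousOn.mono hKΩ).norm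
  have hy1 : 1 ≤ ‖F y‖ := (not_lt.1 (mem_ball_zero_iff.not.1 hx1)).trans (hy hxK)
  have hmax : IsMaxOn (norm ∘ F) Ω y := by
    intro w hw
    by_cases hwK : w ∈ K
    · exact hy hwK
    · exact (mem_ball_zero_iff.1 (hm ⟨hw, hwK⟩)).le.trans hy1
  obtain ⟨w, hw⟩ := hne
  have h1 := Complex.norm_eqOn_of_isPreconnected_of_isMaxOn hc hΩ hF (hKΩ hyK) hmax hw.1
  have h2 := mem_ball_zero_iff.1 (hm hw)
  simp only [Function.comp, Function.const] at h1
  linarith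

theorem squeezingFunction_diff_le (hn : 2 ≤ n) (hΩ : IsOpen Ω) (hc : IsPreconnected Ω)
    (hb : Bornology.IsBounded Ω) (hK : IsCompact K) (hKΩ : K ⊆ Ω) (hD : IsPreconnected (Ω \ K))
    (hz : z ∈ Ω \ K) :
    squeezingFunction (Ω \ K) z ≤
      extendedTanh (kobayashiInfDist Ω z (frontier (Ω \ K) ∩ K)) := by
  -- Nonnegativity of the bound covers an empty family, whose real supremum is 0 by convention.
  refine Real.sSup_le ?_ (extendedTanh_nonneg _)
  rintro _ ⟨F, hF, hm, hFz, rfl⟩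
  refine Real.sSup_le ?_ (extendedTanh_nonneg _)
  rintro r ⟨hr0, hr⟩
  obtain ⟨F', hF', heq⟩ := exists_differentiableOn_eqOn_diff_of_isCompact
    (by simpa using hn) hΩ hb hK hKΩ hD hF.holomorphic
  have hm' : MapsTo F' Ω (ball 0 1) :=
    mapsTo_ball_of_mapsTo_diff hΩ hc hK hKΩ ⟨z, hz⟩ hF' (hm.congr heq.symm)
  have key : ∀ p ∈ frontier (Ω \ K) ∩ K, r ≤ ‖F' p‖ := by
    rintro p ⟨hp, hpK⟩
    by_contra! h
    exact notMem_image_of_isEmbedding_of_mem_closure hF.embedding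
      (hF'.continuousOn.continuousAt (hΩ.mem_nhds (hKΩ hpK))) heq (frontier_subset_closure hp)
      (fun h => h.2 hpK) (hr (mem_ball_zero_iff.2 h))
  rcases (frontier (Ω \ K) ∩ K).eq_empty_or_nonempty with h | ⟨p, hp⟩
  · rw [h]
    simpa [kobayashiInfDist, extendedTanh] using le_one_of_ball_subset_image (by omega) hm hr
  · have hlt : ∀ p ∈ frontier (Ω \ K) ∩ K, ‖F' p‖ < 1 := fun p hp =>
      mem_ball_zero_iff.1 (hm' (hKΩ hp.2))
    have hr1 : r ∈ Ioo (-1 : ℝ) 1 := ⟨by linarith, (key p hp).trans_lt (hlt p hp)⟩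
    refine le_extendedTanh hr1 (le_iInf₂ fun q hq => ?_)
    exact (ENNReal.ofReal_le_ofReal (Real.artanh_le_artanh hr1.1 (hlt q hq) (key q hq))).trans
      (ofReal_artanh_norm_le_kobayashiDist hF' hm' ((heq hz).trans hFz))

/-- Otherwise Ω \ K and the complement of its closure would disconnect Ω. -/
theorem frontier_diff_inter_nonempty {X : Type*} [TopologicalSpace X] {Ω K : Set X}
    (hΩ : IsOpen Ω) (hc : IsPreconnected Ω) (hK : IsClosed K) (hKΩ : K ⊆ Ω) (hne : K.Nonempty)
    (hD : (Ω \ K).Nonempty) : (frontier (Ω \ K) ∩ K).Nonempty := by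
  by_contra! h
  have hDo : IsOpen (Ω \ K) := hΩ.sdiff hK
  have hdisj : ∀ x ∈ K, x ∉ closure (Ω \ K) := by
    intro x hx hxc
    have : x ∈ frontier (Ω \ K) ∩ K := by
      rw [hDo.frontier_eq]
      exact ⟨⟨hxc, fun h => h.2 hx⟩, hx⟩
    rwa [h] at this
  obtain ⟨x, hx⟩ := hne
  obtain ⟨y, -, hy1, hy2⟩ := hc _ _ hDo isClosed_closure.isOpen_compl
    (fun x hx => (em (x ∈ K)).elim (fun h => Or.inr (hdisj x h)) fun h => Or.inl ⟨hx, h⟩)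
    (hD.mono fun _ h => ⟨h.1, h⟩) ⟨x, hKΩ hx, hdisj x hx⟩
  exact hy2 (subset_closure hy1)

end

theorem theorem1p7 {n : ℕ} (hn : 2 ≤ n) (Ω K : Set (EuclideanSpace ℂ (Fin n)))
    (hΩ_open : IsOpen Ω) (hΩ_conn : IsConnected Ω) (hΩ_bdd : Bornology.IsBounded Ω)
    (hK_compact : IsCompact K) (hK_sub : K ⊆ Ω) (hD_conn : IsConnected (Ω \ K)) :
    (∀ z ∈ Ω \ K,
      squeezingFunction (Ω \ K) z ≤
        extendedTanh (kobayashiInfDist Ω z (frontier (Ω \ K) ∩ K))) ∧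
    (K.Nonempty → ¬ IsHolomorphicHomogeneousRegular (Ω \ K)) := by
  have hmain : ∀ z ∈ Ω \ K, squeezingFunction (Ω \ K) z ≤
      extendedTanh (kobayashiInfDist Ω z (frontier (Ω \ K) ∩ K)) := fun z hz =>
    squeezingFunction_diff_le hn hΩ_open hΩ_conn.isPreconnected hΩ_bdd hK_compact hK_sub
      hD_conn.isPreconnected hz
  refine ⟨hmain, fun hne hreg => ?_⟩
  obtain ⟨p, hp⟩ := frontier_diff_inter_nonempty hΩ_open hΩ_conn.isPreconnected
    hK_compact.isClosed hK_sub hne hD_conn.nonempty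
  obtain ⟨ρ, hρ, hρΩ⟩ := Metric.isOpen_iff.1 hΩ_open p (hK_sub hp.2)
  unfold IsHolomorphicHomogeneousRegular at hreg
  set m := ⨅ z : ↥(Ω \ K), squeezingFunction (Ω \ K) (z : EuclideanSpace ℂ (Fin n)) with hm
  -- The radius ρ keeps z in a ball inside Ω; the radius ρm makes the resulting bound ‖z - p‖/ρ
  -- smaller than the infimum m.
  obtain ⟨z, hz, hzp⟩ := Metric.mem_closure_iff.1 (frontier_subset_closure hp.1) (min ρ (ρ * m))
    (by positivity)
  rw [dist_comm, dist_eq_norm, lt_min_iff] at hzp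
  have h1 : m ≤ squeezingFunction (Ω \ K) z :=
    ciInf_le ⟨0, by rintro _ ⟨w, rfl⟩; exact squeezingFunction_nonneg _ _⟩ (⟨z, hz⟩ : ↥(Ω \ K))
  have h2 : extendedTanh (kobayashiInfDist Ω z (frontier (Ω \ K) ∩ K)) ≤ ‖z - p‖ / ρ := by
    refine extendedTanh_le ⟨by positivity, (div_lt_one hρ).2 hzp.1⟩ ((iInf₂_le p hp).trans ?_)
    exact kobayashiDist_le_of_ball_subset hρΩ (by rw [mem_ball, dist_eq_norm]; exact hzp.1)
  have h3 : ‖z - p‖ / ρ < m := by rw [div_lt_iff₀' hρ]; exact hzp.2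
  linarith [hmain z hz]
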